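/- Let $C_1=\begin{pmatrix}1&1&0\\0&0&1\\0&1&0\end{pmatrix}$, $C_2=\begin{pmatrix}0&1&0\\1&0&0\\0&1&1\end{pmatrix}$, and let $\Delta=\{\mathbf x\in\mathbb R^3_{\ge 0} : \|\mathbf x\|_1=1\}$. Let $F_C(x_1,x_2,x_3)=(x_1-x_3,x_3,x_2)$ if $x_1\ge x_3$ and $F_C(x_1,x_2,x_3)=(x_2,x_1,x_3-x_1)$ if $x_1<x_3$, and let $f_C:\Delta\to\Delta$, $f_C(\mathbf x)=F_C(\mathbf x)/\|F_C(\mathbf x)\|_1$, be the Cassaigne map. Let $S$ be the shift on $\{1,2\}^{\mathbb N}$ (with the product topology); all spaces carry their Borel $\sigma$-algebras. Let $\delta:\Delta\to\{1,2\}^{\mathbb N}$ be the coding map: the $n$-th letter of $\delta(\mathbf x)$ is $1$ if $\mathbf y=f_C^n(\mathbf x)$ satisfies $y_1\ge y_3$, and $2$ if $y_1<y_3$. Let $\mathcal P$ be the set of primitive sequences, i.e. of $(i_n)\in\{1,2\}^{\mathbb N}$ such that for every $r$ there is $s>r$ for which $C_{i_r}\cdots C_{i_{s-1}}$ has only positive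 entries, and let $\mathcal I$ be the set of totally irrational vectors, i.e. of $\mathbf x\in\Delta$ whose three entries are linearly independent over $\mathbb Q$. A measure-preserving system is a triple $(X,T,\mu)$ with $\mu$ a $T$-invariant probability measure. An isomorphism from $(X,T,\mu)$ to $(Y,U,\nu)$ is a map $\varphi$ for which there are measurable sets $X'\subset X$, $Y'\subset Y$ of measure one with $T(X')\subset X'$, $U(Y')\subset Y'$, such that $\varphi$ restricts to a bijection $X'\to Y'$ that is measurable with measurable inverse, preserves the measures, and satisfies $\varphi\circ T=U\circ\varphi$ on $X'$. **Theorem A.** The system $(\{1,2\}^{\mathbb N},S)$ is a symbolic representation of $(\Delta,f_C)$, in the following sense. For every $(i_n)\in\{1,2\}^{\mathbb N}$ there is a unique point $\pi((i_n))\in\Delta$ with $$\bigcap_{n\ge 0}C_{i_0}C_{i_1}\cdots C_{i_n}\mathbb R^3_{\ge 0}=\mathbb R_{\ge 0}\,\pi((i_n)).$$ The map $\pi:\{1,2\}^{\mathbb N}\to\Delta$ is continuous and onto; $\pi\circ\delta=\mathrm{id}_\Delta$ and $\delta\circ f_C=S\circ\delta$; and $\pi$ restricts to a bijection $\mathcal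 P\to\mathcal I$ with $\pi\circ S=f_C\circ\pi$ on $\mathcal P$. Moreover: 1. for every $S$-invariant Borel probability measure $\mu$ on $\{1,2\}^{\mathbb N}$ with $\mu(\mathcal P)=1$, the map $\pi$ is an isomorphism of measure-preserving systems from $(\{1,2\}^{\mathbb N},S,\mu)$ to $(\Delta,f_C,\pi_*\mu)$; 2. for every $f_C$-invariant Borel probability measure $\nu$ on $\Delta$ with $\nu(\mathcal I)=1$, the map $\pi$ is an isomorphism of measure-preserving systems from $(\{1,2\}^{\mathbb N},S,\pi^{-1}_*\nu)$ to $(\Delta,f_C,\nu)$, where $\pi^{-1}_*\nu$ is the push-forward of $\nu$ by the inverse $\pi^{-1}:\mathcal I\to\mathcal P$ of the restricted map (defined $\nu$-almost everywhere). -/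

import Mathlib

open MeasureTheory Set

namespace Cassaigne

/-- The simplex `Δ`: vectors of `ℝ³` with nonnegative entries and `ℓ¹`-norm one, with the
subspace topology and its Borel `σ`-algebra. -/
abbrev Simplex : Type := stdSimplex ℝ (Fin 3)

/-- Sequences over the two-letter alphabet `{1,2}`, with the product topology and its Borel
`σ`-algebra. The letter `1` is written `0 : Fin 2` and the letter `2` is written `1 : Fin 2`. -/
abbrev Seq : Type := ℕ → Fin 2

/-- The shift `S`. -/
def shift (i : Seq) : Seq := fun n => i (n + 1)

/-- The two matrices: `C 0` is `C₁` and `C 1` is `C₂`. -/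
def C : Fin 2 → Matrix (Fin 3) (Fin 3) ℝ :=
  ![!![1, 1, 0; 0, 0, 1; 0, 1, 0], !![0, 1, 0; 1, 0, 0; 0, 1, 1]]

/-- The block product `M_{[r,s)} = M_r M_{r+1} ⋯ M_{s-1}`. -/
def blockProd (M : ℕ → Matrix (Fin 3) (Fin 3) ℝ) (r s : ℕ) : Matrix (Fin 3) (Fin 3) ℝ :=
  ((List.Ico r s).map M).prod

/-- The set `𝒫` of sequences `i` for which `(C_{i_n})` is primitive. -/
def primitiveSeqs : Set Seq :=
  {i | ∀ r, ∃ s, r < s ∧ ∀ a b, 0 < blockProd (fun n => C (i n)) r s a b}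

/-- The cone `⋂_{n ≥ 0} C_{i_0} C_{i_1} ⋯ C_{i_n} ℝ³_{≥0}`. -/
def limitCone (i : Seq) : Set (Fin 3 → ℝ) :=
  ⋂ n : ℕ, (fun v => (blockProd (fun k => C (i k)) 0 (n + 1)).mulVec v) '' {v | ∀ a, 0 ≤ v a}

/-- The half-line `ℝ_{≥0} f`. -/
def ray (f : Fin 3 → ℝ) : Set (Fin 3 → ℝ) := {v | ∃ c : ℝ, 0 ≤ c ∧ v = c • f}

/-- The set `ℐ` of totally irrational vectors: those with rationally independent entries. -/
def irrationalVectors : Set Simplex := {x | LinearIndependent ℚ (fun a => x.1 a)}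

/-- The unnormalized algorithm `F_C`. -/
noncomputable def F (x : Fin 3 → ℝ) : Fin 3 → ℝ :=
  if x 2 ≤ x 0 then ![x 0 - x 2, x 2, x 1] else ![x 1, x 0, x 2 - x 0]

/-- The `ℓ¹`-norm. -/
def l1 (x : Fin 3 → ℝ) : ℝ := ∑ a, |x a|

theorem F_nonneg {x : Fin 3 → ℝ} (hx : ∀ a, 0 ≤ x a) (a : Fin 3) : 0 ≤ F x a := by
  have h0 := hx 0
  have h1 := hx 1
  have h2 := hx 2
  unfold F
  split_ifs with h <;> fin_cases a <;> simp <;> linarith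

theorem l1_F_pos (x : Simplex) : 0 < l1 (F x.1) := by
  have h0 := x.2.1 0
  have h1 := x.2.1 1
  have h2 := x.2.1 2
  have hs := x.2.2
  rw [Fin.sum_univ_three] at hs
  have e : l1 (F x.1) = ∑ a, F x.1 a :=
    Finset.sum_congr rfl fun a _ => abs_of_nonneg (F_nonneg x.2.1 a)
  rw [e, Fin.sum_univ_three]
  unfold F
  split_ifs with h
  · simp
    linarith
  · simp
    linarith

/-- The Cassaigne map `f_C(x) = F_C(x) / ‖F_C(x)‖₁` on the simplex. -/
noncomputable def f (x : Simplex) : Simplex :=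
  ⟨fun a => F x.1 a / l1 (F x.1),
    fun a => div_nonneg (F_nonneg x.2.1 a) (l1_F_pos x).le, by
      rw [← Finset.sum_div, div_eq_one_iff_eq (l1_F_pos x).ne']
      exact (Finset.sum_congr rfl fun a _ => abs_of_nonneg (F_nonneg x.2.1 a)).symm⟩

/-- The coding `δ`: the `n`-th letter of `δ(x)` is `1` if `f_C^n(x)` satisfies `x₁ ≥ x₃`, and `2`
otherwise. -/
noncomputable def coding (x : Simplex) : Seq :=
  fun n => if (f^[n] x).1 2 ≤ (f^[n] x).1 0 then 0 else 1

theorem simplex_nonempty : Nonempty Simplex :=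
  ⟨⟨Pi.single 0 1, single_mem_stdSimplex ℝ 0⟩⟩

/-- The map `π`: the point `f` of the simplex such that the limit cone of `i` is `ℝ_{≥0} f`.
At most one such point exists; that one exists for every `i` is not part of the definition. -/
noncomputable def proj (i : Seq) : Simplex :=
  @Classical.epsilon Simplex simplex_nonempty (fun x => limitCone i = ray x.1)

/-- The inverse `π⁻¹ : ℐ → 𝒫` of the restriction of `π` to `𝒫` (with irrelevant values at points
that are not in `π(𝒫)`). -/
noncomputable def projInv (x : Simplex) : Seq := Function.invFunOn proj primitiveSeqs x

/-- `(X, T, μ)` is a measure-preserving dynamical system. -/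
structure IsMPSystem {X : Type*} [MeasurableSpace X] (T : X → X) (μ : Measure X) : Prop where
  prob : IsProbabilityMeasure μ
  invariant : MeasurePreserving T μ μ

/-- `φ` is an isomorphism of the measure-preserving dynamical systems `(X, T, μ)` and
`(Y, U, ν)`: it restricts to an invertible measure-preserving map between forward-invariant
measurable sets of measure one, and intertwines `T` and `U` there. -/
structure IsMPIsomorphism {X Y : Type*} [MeasurableSpace X] [MeasurableSpace Y]
    (T : X → X) (μ : Measure X) (U : Y → Y) (ν : Measure Y) (φ : X → Y) : Prop where
  source : IsMPSystem T μ
  target : IsMPSystem U ν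
  restrict : ∃ (X' : Set X) (Y' : Set Y),
    MeasurableSet X' ∧ MeasurableSet Y' ∧ μ X' = 1 ∧ ν Y' = 1 ∧
    MapsTo T X' X' ∧ MapsTo U Y' Y' ∧
    (∃ e : X' ≃ᵐ Y', (∀ x : X', (e x : Y) = φ x) ∧
      MeasurePreserving e (μ.comap Subtype.val) (ν.comap Subtype.val)) ∧
    ∀ x ∈ X', φ (T x) = U (φ x)

end Cassaigne

namespace Cassaigne

open Filter Topology Matrix

/-! The cones spanned by the columns of `C (i 0) ⋯ C (i (n-1))` are nested, and everything rests on
their sections with the simplex shrinking to a point for every `i`, primitive or not. Let `l` be the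
row of column sums and `y` any row of the product; the ratios `y j / l j` are coordinates of the
normalized columns. Over four letters their oscillation contracts by a factor controlled by the
relative growth of the largest column sum (`osc_contract`). If the oscillation stayed above some `d
> 0`, the logarithm of that sum would be bounded, whereas the column sums grow at least linearly
(`exists_osc_lt`). Compactness and shrinking give existence, uniqueness and continuity of `π`.

Since `C c *ᵥ F x = x` for the letter `c` read off `x`, every `x` lies in all cones of its own
coding, so `π ∘ δ = id`. If `x` is totally irrational, its orbit is totally irrational, hence
positive, and small cones around positive points have positive columns: the coding is primitive.
Conversely, for primitive `i` the point `π i` is `C (i 0) *ᵥ w` with `w` positive, which reveals `i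
0`; hence `δ` inverts `π` on primitive sequences.

It remains that primitive sequences give totally irrational points. An integer relation yields
integer row vectors orthogonal to positive vectors, so always of mixed sign. An integer width cannot
increase along them; once it is constant, the letters come in equal pairs
(`exists_paired_of_mixed`). Both squares `C c * C c` fix the middle unit row, which contradicts
primitivity. -/

/-! ### Row vectors driven by letters: growth and contraction -/

/-- The action of the matrix `C c` on row vectors. -/
def step {R : Type*} [Add R] (c : Fin 2) (v : Fin 3 → R) : Fin 3 → R :=
  if c = 0 then ![v 0, v 0 + v 2, v 1] else ![v 1, v 0 + v 2, v 2]

theorem step_zero {R : Type*} [Add R] (v : Fin 3 → R) : step 0 v = ![v 0, v 0 + v 2, v 1] := rfl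

theorem step_one {R : Type*} [Add R] (v : Fin 3 → R) : step 1 v = ![v 1, v 0 + v 2, v 2] := rfl

/-- The sequence of row vectors `h` is driven by the letters `i`. -/
def Driven {R : Type*} [Add R] (i : Seq) (h : ℕ → Fin 3 → R) : Prop :=
  ∀ n, h (n + 1) = step (i n) (h n)

theorem fin_two_cases (c : Fin 2) : c = 0 ∨ c = 1 := by
  fin_cases c <;> simp

theorem Driven.lin {i : Seq} {h l : ℕ → Fin 3 → ℝ} (H : Driven i h) (L : Driven i l) (s t : ℝ) :
    Driven i (fun n j => s * l n j + t * h n j) := by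
  intro n
  funext j
  simp only [H n, L n]
  rcases fin_two_cases (i n) with e | e <;> rw [e] <;> fin_cases j <;>
    simp [step_zero, step_one] <;> ring

/-- Within four letters, some column gets contained in all columns, and this column dominates the
growth of the maximal column. -/
theorem exists_common_column (i : Seq) (n : ℕ) : ∃ j : Fin 3,
    (∀ h : ℕ → Fin 3 → ℝ, Driven i h → (∀ k, 0 ≤ h n k) → ∀ k, h n j ≤ h (n + 4) k) ∧
    (∀ l : ℕ → Fin 3 → ℝ, Driven i l → (∀ k, 0 ≤ l n k) →
      ∀ k, ∃ k', l (n + 2) k ≤ l (n + 1) k' + l n j) := by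
  have key : ∀ a b c d : Fin 2, ∃ j : Fin 3,
      (∀ v : Fin 3 → ℝ, (∀ k, 0 ≤ v k) → ∀ k, v j ≤ step d (step c (step b (step a v))) k) ∧
      (∀ v : Fin 3 → ℝ, (∀ k, 0 ≤ v k) → ∀ k, ∃ k', step b (step a v) k ≤ step a v k' + v j) := by
    have aux : ∀ a b c d : Fin 2, ∀ j : Fin 3,
      -- The column created by the second letter is `v 0 + v 1` if `a = 0` and `v 1 + v 2` if `a =
      -- 1`. The column `j` is one of its two summands, which gives the growth bound; the later
      -- letters decide which summand has entered every column after four steps.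
      j = (if a = b then (if a = 0 then 0 else 2) else
        if a = 1 then (if c = 1 ∧ d = 1 then 2 else 1) else (if c = 0 ∧ d = 0 then 0 else 1)) →
      (∀ v : Fin 3 → ℝ, (∀ k, 0 ≤ v k) → ∀ k, v j ≤ step d (step c (step b (step a v))) k) ∧
      (∀ v : Fin 3 → ℝ, (∀ k, 0 ≤ v k) →
        ∀ k, ∃ k', step b (step a v) k ≤ step a v k' + v j) := by
      intro a b c d j hj
      refine ⟨fun v hv k => ?_, fun v hv k => ?_⟩
      · have h0 := hv 0
        have h1 := hv 1
        have h2 := hv 2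
        subst hj
        rcases fin_two_cases a with rfl | rfl <;> rcases fin_two_cases b with rfl | rfl <;>
          rcases fin_two_cases c with rfl | rfl <;> rcases fin_two_cases d with rfl | rfl <;>
          fin_cases k <;> simp [step_zero, step_one] <;> linarith
      · have h0 := hv 0
        have h1 := hv 1
        have h2 := hv 2
        subst hj
        rcases fin_two_cases a with rfl | rfl <;> rcases fin_two_cases b with rfl | rfl <;>
          rcases fin_two_cases c with rfl | rfl <;> rcases fin_two_cases d with rfl | rfl <;>
          fin_cases k <;>
          first
          | (refine ⟨0, ?_⟩; simp [step_zero, step_one]; done)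
          | (refine ⟨1, ?_⟩; simp [step_zero, step_one]; done)
          | (refine ⟨2, ?_⟩; simp [step_zero, step_one]; done)
          | (refine ⟨0, ?_⟩; simp [step_zero, step_one]; linarith)
          | (refine ⟨1, ?_⟩; simp [step_zero, step_one]; linarith)
          | (refine ⟨2, ?_⟩; simp [step_zero, step_one]; linarith)
    exact fun a b c d => ⟨_, aux a b c d _ rfl⟩
  obtain ⟨j, h1, h2⟩ := key (i n) (i (n + 1)) (i (n + 2)) (i (n + 3))
  refine ⟨j, fun h H hn k => ?_, fun l L hn k => ?_⟩
  · rw [H (n + 3), H (n + 2), H (n + 1), H n]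
    exact h1 _ hn k
  · rw [L (n + 1), L n]
    exact h2 _ hn k

/-- The largest coordinate. -/
noncomputable def top (v : Fin 3 → ℝ) : ℝ := max (max (v 0) (v 1)) (v 2)

theorem le_top (v : Fin 3 → ℝ) (j : Fin 3) : v j ≤ top v := by
  fin_cases j <;> simp [top]

theorem top_le {v : Fin 3 → ℝ} {c : ℝ} (h : ∀ j, v j ≤ c) : top v ≤ c :=
  max_le (max_le (h 0) (h 1)) (h 2)

theorem top_step_le {c : Fin 2} {v : Fin 3 → ℝ} (hv : ∀ j, 0 ≤ v j) :
    top (step c v) ≤ 2 * top v := by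
  have h0 := hv 0
  have h1 := hv 1
  have h2 := hv 2
  have t0 := le_top v 0
  have t1 := le_top v 1
  have t2 := le_top v 2
  apply top_le
  intro j
  rcases fin_two_cases c with rfl | rfl <;> fin_cases j <;> simp [step_zero, step_one] <;> linarith

theorem top_le_step {c : Fin 2} {v : Fin 3 → ℝ} (hv : ∀ j, 0 ≤ v j) :
    top v ≤ top (step c v) := by
  have h0 := hv 0
  have h2 := hv 2
  have t0 := le_top (step c v) 0
  have t1 := le_top (step c v) 1
  have t2 := le_top (step c v) 2
  apply top_le
  intro j
  rcases fin_two_cases c with rfl | rfl <;> fin_cases j <;>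
    simp [step_zero, step_one] at * <;> linarith

theorem Driven.one_le {i : Seq} {l : ℕ → Fin 3 → ℝ} (L : Driven i l) (l0 : ∀ j, 1 ≤ l 0 j)
    (n : ℕ) (j : Fin 3) : 1 ≤ l n j := by
  induction n generalizing j with
  | zero => exact l0 j
  | succ n ih =>
    have h0 := ih 0
    have h1 := ih 1
    have h2 := ih 2
    rw [L]
    rcases fin_two_cases (i n) with e | e <;> rw [e] <;> fin_cases j <;>
      simp [step_zero, step_one] <;> linarith

theorem Driven.le_sum {i : Seq} {l : ℕ → Fin 3 → ℝ} (L : Driven i l) (l0 : ∀ j, 1 ≤ l 0 j)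
    (n : ℕ) : (n : ℝ) ≤ l n 0 + l n 1 + l n 2 := by
  induction n with
  | zero =>
    have h0 := l0 0
    have h1 := l0 1
    have h2 := l0 2
    push_cast
    linarith
  | succ n ih =>
    have h0 := L.one_le l0 n 0
    have h2 := L.one_le l0 n 2
    rw [L]
    push_cast
    rcases fin_two_cases (i n) with e | e <;> rw [e] <;>
      simp [step_zero, step_one] <;> linarith

/-- The oscillation of the ratios `y j / l j`. -/
noncomputable def osc (l y : Fin 3 → ℝ) : ℝ :=
  top (fun j => y j / l j) + top (fun j => -(y j / l j))

/-- Both `hi * l - y` and `lo * l + y` are nonnegative and driven, so their `j`-th entries at time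
`n` bound all their entries from below at time `n + 4`. Adding the two gains removes the fraction `l
n j / top (l (n + 4))` of the oscillation, and `l n j` is at least the growth of the largest entry.
-/
theorem osc_contract {i : Seq} {l y : ℕ → Fin 3 → ℝ} (L : Driven i l) (Y : Driven i y)
    (l0 : ∀ j, 1 ≤ l 0 j) (n : ℕ) :
    osc (l (n + 4)) (y (n + 4)) ≤ osc (l n) (y n) -
      osc (l n) (y n) * ((top (l (n + 2)) - top (l (n + 1))) / (8 * top (l (n + 1)))) ∧
    0 ≤ osc (l n) (y n) := by
  obtain ⟨j, hj, gj⟩ := exists_common_column i n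
  have lpos : ∀ n k, 0 < l n k := fun n k => zero_lt_one.trans_le (L.one_le l0 n k)
  have lnn : ∀ n k, 0 ≤ l n k := fun n k => (lpos n k).le
  have tpos : ∀ n, 0 < top (l n) := fun n => (lpos n 0).trans_le (le_top _ _)
  set hi := top (fun j => y n j / l n j) with hhi
  set lo := top (fun j => -(y n j / l n j)) with hlo
  have A : ∀ k, 0 ≤ hi * l n k + (-1) * y n k := by
    intro k
    have := le_top (fun j => y n j / l n j) k
    rw [← hhi, div_le_iff₀ (lpos n k)] at this
    linarith
  have B : ∀ k, 0 ≤ lo * l n k + 1 * y n k := by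
    intro k
    have := le_top (fun j => -(y n j / l n j)) k
    rw [← hlo, ← neg_div, div_le_iff₀ (lpos n k)] at this
    linarith
  have A' := hj _ (Y.lin L hi (-1)) A
  have B' := hj _ (Y.lin L lo 1) B
  have hosc : osc (l n) (y n) = hi + lo := rfl
  have osc0 : 0 ≤ hi + lo := by
    have a := A 0
    have b := B 0
    have : 0 ≤ (hi + lo) * l n 0 := by linarith
    exact nonneg_of_mul_nonneg_left this (lpos n 0)
  refine ⟨?_, hosc ▸ osc0⟩
  set T := top (l (n + 4)) with hT
  have C1 : top (fun j => y (n + 4) j / l (n + 4) j) ≤ hi - (hi * l n j + (-1) * y n j) / T := by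
    apply top_le
    intro k
    have h1 : (hi * l n j + (-1) * y n j) / T ≤ (hi * l n j + (-1) * y n j) / l (n + 4) k :=
      div_le_div_of_nonneg_left (A j) (lpos _ _) (le_top _ _)
    have h2 : (hi * l n j + (-1) * y n j) / l (n + 4) k ≤ hi - y (n + 4) k / l (n + 4) k := by
      rw [div_le_iff₀ (lpos _ _), sub_mul, div_mul_cancel₀ _ (lpos _ _).ne']
      have := A' k
      linarith
    linarith
  have C2 : top (fun j => -(y (n + 4) j / l (n + 4) j)) ≤ lo - (lo * l n j + 1 * y n j) / T := by
    apply top_le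
    intro k
    have h1 : (lo * l n j + 1 * y n j) / T ≤ (lo * l n j + 1 * y n j) / l (n + 4) k :=
      div_le_div_of_nonneg_left (B j) (lpos _ _) (le_top _ _)
    have h2 : (lo * l n j + 1 * y n j) / l (n + 4) k ≤ lo + y (n + 4) k / l (n + 4) k := by
      rw [div_le_iff₀ (lpos _ _), add_mul, div_mul_cancel₀ _ (lpos _ _).ne']
      have := B' k
      linarith
    linarith
  have C3 : osc (l (n + 4)) (y (n + 4)) ≤ (hi + lo) - (hi + lo) * (l n j / T) := by
    have e : (hi * l n j + (-1) * y n j) / T + (lo * l n j + 1 * y n j) / T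
        = (hi + lo) * (l n j / T) := by ring
    unfold osc
    linarith
  have growth : top (l (n + 2)) - top (l (n + 1)) ≤ l n j := by
    have : top (l (n + 2)) ≤ top (l (n + 1)) + l n j := by
      apply top_le
      intro k
      obtain ⟨k', hk'⟩ := gj l L (lnn n) k
      exact hk'.trans (by linarith [le_top (l (n + 1)) k'])
    linarith
  -- Three letters, each at most doubling the largest entry.
  have T8 : T ≤ 8 * top (l (n + 1)) := by
    have a1 : top (l (n + 2)) ≤ 2 * top (l (n + 1)) := by
      rw [L (n + 1)]; exact top_step_le (lnn _)
    have a2 : top (l (n + 3)) ≤ 2 * top (l (n + 2)) := by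
      rw [L (n + 2)]; exact top_step_le (lnn _)
    have a3 : T ≤ 2 * top (l (n + 3)) := by
      rw [hT, L (n + 3)]; exact top_step_le (lnn _)
    linarith
  have fin : (top (l (n + 2)) - top (l (n + 1))) / (8 * top (l (n + 1))) ≤ l n j / T := by
    calc _ ≤ l n j / (8 * top (l (n + 1))) :=
          div_le_div_of_nonneg_right growth (by have := tpos (n + 1); positivity)
      _ ≤ l n j / T := div_le_div_of_nonneg_left (lnn _ _) (tpos _) T8
  rw [hosc]
  have := mul_le_mul_of_nonneg_left fin osc0
  linarith

/-- Oscillations become arbitrarily small. -/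
theorem exists_osc_lt {i : Seq} {l y : ℕ → Fin 3 → ℝ} (L : Driven i l) (Y : Driven i y)
    (l0 : ∀ j, 1 ≤ l 0 j) {d : ℝ} (hd : 0 < d) : ∃ n, osc (l n) (y n) < d := by
  by_contra! hcon
  have lpos : ∀ n k, 0 < l n k := fun n k => zero_lt_one.trans_le (L.one_le l0 n k)
  have tpos : ∀ n, 0 < top (l n) := fun n => (lpos n 0).trans_le (le_top _ _)
  have tmono : ∀ n, top (l n) ≤ top (l (n + 1)) := fun n => by
    rw [L n]; exact top_le_step fun k => (lpos n k).le
  set D : ℕ → ℝ := fun n => osc (l n) (y n) with hD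
  -- A Lyapunov function: the sum of four terms telescopes because contraction takes four letters,
  -- and the weight `8 / d` makes the loss of oscillation pay for the logarithmic growth through
  -- `log x ≤ x - 1`.
  set E : ℕ → ℝ := fun n =>
    8 / d * (D n + D (n + 1) + D (n + 2) + D (n + 3)) + Real.log (top (l (n + 1))) with hE
  have hlog : ∀ n, Real.log (top (l (n + 2))) - Real.log (top (l (n + 1))) ≤
      (top (l (n + 2)) - top (l (n + 1))) / top (l (n + 1)) := by
    intro n
    rw [← Real.log_div (tpos _).ne' (tpos _).ne']
    refine (Real.log_le_sub_one_of_pos (div_pos (tpos _) (tpos _))).trans_eq ?_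
    rw [sub_div, div_self (tpos _).ne']
  have hstep : ∀ n, E (n + 1) ≤ E n := by
    intro n
    obtain ⟨hc, -⟩ := osc_contract L Y l0 n
    have hg : 0 ≤ (top (l (n + 2)) - top (l (n + 1))) / top (l (n + 1)) :=
      div_nonneg (sub_nonneg.2 (tmono (n + 1))) (tpos _).le
    have e : (top (l (n + 2)) - top (l (n + 1))) / (8 * top (l (n + 1))) =
        (top (l (n + 2)) - top (l (n + 1))) / top (l (n + 1)) / 8 := by
      rw [mul_comm, ← div_div]
    rw [e] at hc
    have h1 := mul_le_mul_of_nonneg_right (hcon n) (div_nonneg hg (by norm_num : (0 : ℝ) ≤ 8))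
    have h2 : D (n + 4) - D n ≤
        -(d * ((top (l (n + 2)) - top (l (n + 1))) / top (l (n + 1)) / 8)) := by
      simp only [hD]
      linarith
    have h3 := mul_le_mul_of_nonneg_left h2 (div_nonneg (by norm_num : (0 : ℝ) ≤ 8) hd.le)
    have h4 : 8 / d * -(d * ((top (l (n + 2)) - top (l (n + 1))) / top (l (n + 1)) / 8)) =
        -((top (l (n + 2)) - top (l (n + 1))) / top (l (n + 1))) := by
      field_simp
    have h5 := hlog n
    rw [h4] at h3
    simp only [hE]
    rw [show n + 1 + 1 = n + 2 from rfl, show n + 1 + 2 = n + 3 from rfl,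
      show n + 1 + 3 = n + 4 from rfl]
    linarith
  have hbound : ∀ n, Real.log (top (l (n + 1))) ≤ E 0 := by
    intro n
    have hanti : E n ≤ E 0 := antitone_nat_of_succ_le hstep (Nat.zero_le n)
    have hpos : 0 ≤ 8 / d * (D n + D (n + 1) + D (n + 2) + D (n + 3)) := by
      have := fun n => (osc_contract L Y l0 n).2
      have a0 := this n
      have a1 := this (n + 1)
      have a2 := this (n + 2)
      have a3 := this (n + 3)
      positivity
    simp only [hE] at hanti ⊢
    linarith
  obtain ⟨n, hn⟩ := exists_nat_gt (3 * Real.exp (E 0))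
  have h1 := L.le_sum l0 (n + 1)
  have h2 : top (l (n + 1)) ≤ Real.exp (E 0) := by
    rw [← Real.log_le_iff_le_exp (tpos _)]
    exact hbound n
  have t0 := le_top (l (n + 1)) 0
  have t1 := le_top (l (n + 1)) 1
  have t2 := le_top (l (n + 1)) 2
  push_cast at h1
  linarith

/-! ### Matrix products and primitivity -/

/-- The product of the first `n` matrices along `i`. -/
noncomputable def prodMat (i : Seq) (n : ℕ) : Matrix (Fin 3) (Fin 3) ℝ :=
  blockProd (fun k => C (i k)) 0 n

theorem vecMul_C (c : Fin 2) (v : Fin 3 → ℝ) : v ᵥ* C c = step c v := by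
  rcases fin_two_cases c with rfl | rfl <;> funext j <;> fin_cases j <;>
    simp [step_zero, step_one, C, Matrix.vecMul, dotProduct, Fin.sum_univ_three]

theorem C_zero_mulVec (v : Fin 3 → ℝ) : C 0 *ᵥ v = ![v 0 + v 1, v 2, v 1] := by
  funext j
  fin_cases j <;> simp [C, Matrix.mulVec, dotProduct, Fin.sum_univ_three]

theorem C_one_mulVec (v : Fin 3 → ℝ) : C 1 *ᵥ v = ![v 1, v 0, v 1 + v 2] := by
  funext j
  fin_cases j <;> simp [C, Matrix.mulVec, dotProduct, Fin.sum_univ_three]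

theorem C_mulVec_nonneg (c : Fin 2) {v : Fin 3 → ℝ} (hv : ∀ a, 0 ≤ v a) (a : Fin 3) :
    0 ≤ (C c *ᵥ v) a := by
  have h0 := hv 0
  have h1 := hv 1
  have h2 := hv 2
  rcases fin_two_cases c with rfl | rfl <;> fin_cases a <;>
    simp [C_zero_mulVec, C_one_mulVec] <;> linarith

theorem blockProd_self (M : ℕ → Matrix (Fin 3) (Fin 3) ℝ) (r : ℕ) : blockProd M r r = 1 := by
  simp [blockProd]

theorem blockProd_succ (M : ℕ → Matrix (Fin 3) (Fin 3) ℝ) {r s : ℕ} (h : r ≤ s) :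
    blockProd M r (s + 1) = blockProd M r s * M s := by
  simp [blockProd, List.Ico.succ_top h]

theorem prodMat_zero (i : Seq) : prodMat i 0 = 1 := blockProd_self _ _

theorem prodMat_succ (i : Seq) (n : ℕ) : prodMat i (n + 1) = prodMat i n * C (i n) :=
  blockProd_succ _ n.zero_le

theorem shift_iterate (i : Seq) (r n : ℕ) : (shift^[r] i) n = i (n + r) := by
  induction r generalizing n with
  | zero => rfl
  | succ r ih =>
    rw [Function.iterate_succ_apply']
    change (shift^[r] i) (n + 1) = _
    rw [ih, add_assoc, add_comm 1]

theorem blockProd_eq_prodMat_shift (i : Seq) (r k : ℕ) :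
    blockProd (fun n => C (i n)) r (r + k) = prodMat (shift^[r] i) k := by
  induction k with
  | zero => rw [prodMat_zero, add_zero, blockProd_self]
  | succ k ih =>
    rw [prodMat_succ, ← ih, ← add_assoc, blockProd_succ _ (r.le_add_right k), shift_iterate,
      add_comm k r]

theorem prodMat_succ' (i : Seq) (n : ℕ) : prodMat i (n + 1) = C (i 0) * prodMat (shift i) n := by
  induction n with
  | zero => simp [prodMat_succ, prodMat_zero]
  | succ n ih => rw [prodMat_succ, ih, prodMat_succ, Matrix.mul_assoc]; rfl

theorem prodMat_add (i : Seq) (r n : ℕ) :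
    prodMat i (r + n) = prodMat i r * prodMat (shift^[r] i) n := by
  induction n with
  | zero => simp [prodMat_zero]
  | succ n ih =>
    rw [← add_assoc, prodMat_succ, ih, prodMat_succ, Matrix.mul_assoc, shift_iterate, add_comm n r]

theorem mem_primitiveSeqs {i : Seq} :
    i ∈ primitiveSeqs ↔ ∀ r, ∃ k, ∀ a b, 0 < prodMat (shift^[r] i) k a b := by
  constructor
  · intro h r
    obtain ⟨s, hs, hp⟩ := h r
    obtain ⟨k, rfl⟩ := Nat.exists_eq_add_of_le hs.le
    rw [blockProd_eq_prodMat_shift] at hp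
    exact ⟨k, hp⟩
  · intro h r
    obtain ⟨k, hk⟩ := h r
    refine ⟨r + k, ?_, ?_⟩
    · rcases Nat.eq_zero_or_pos k with rfl | h0
      · have := hk 0 1
        simp [prodMat_zero] at this
      · omega
    · rw [blockProd_eq_prodMat_shift]
      exact hk

theorem shift_mem_primitiveSeqs {i : Seq} (h : i ∈ primitiveSeqs) : shift i ∈ primitiveSeqs := by
  rw [mem_primitiveSeqs] at h ⊢
  intro r
  have := h (r + 1)
  rwa [Function.iterate_succ_apply] at this

theorem driven_vecMul (i : Seq) (y : Fin 3 → ℝ) : Driven i (fun n => y ᵥ* prodMat i n) := by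
  intro n
  simp only
  rw [prodMat_succ, ← Matrix.vecMul_vecMul, vecMul_C]

theorem driven_row (i : Seq) (a : Fin 3) : Driven i (fun n => prodMat i n a) := by
  intro n
  simp only
  rw [prodMat_succ, ← vecMul_C]
  rfl

theorem isUnit_C (c : Fin 2) : IsUnit (C c) := by
  rw [Matrix.isUnit_iff_isUnit_det]
  rcases fin_two_cases c with rfl | rfl <;> simp [C, Matrix.det_fin_three]

theorem isUnit_prodMat (i : Seq) (n : ℕ) : IsUnit (prodMat i n) := by
  induction n with
  | zero => rw [prodMat_zero]; exact isUnit_one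
  | succ n ih => rw [prodMat_succ]; exact ih.mul (isUnit_C _)

/-! ### Nested cones, the limit ray and continuity of `π` -/

/-- The cone spanned by the columns of `prodMat i n`. -/
def cone (i : Seq) (n : ℕ) : Set (Fin 3 → ℝ) := (fun v => prodMat i n *ᵥ v) '' {v | ∀ a, 0 ≤ v a}

theorem limitCone_eq (i : Seq) : limitCone i = ⋂ n, cone i (n + 1) := rfl

theorem cone_succ_subset (i : Seq) (n : ℕ) : cone i (n + 1) ⊆ cone i n := by
  rintro _ ⟨v, hv, rfl⟩
  refine ⟨C (i n) *ᵥ v, C_mulVec_nonneg _ hv, ?_⟩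
  simp only
  rw [prodMat_succ, Matrix.mulVec_mulVec]

theorem cone_antitone (i : Seq) : Antitone (cone i) := antitone_nat_of_succ_le (cone_succ_subset i)

theorem mem_limitCone {i : Seq} {v : Fin 3 → ℝ} : v ∈ limitCone i ↔ ∀ n, v ∈ cone i n := by
  rw [limitCone_eq, mem_iInter]
  exact ⟨fun h n => cone_succ_subset i n (h n), fun h n => h _⟩

theorem nonneg_of_mem_cone {i : Seq} {n : ℕ} {v : Fin 3 → ℝ} (h : v ∈ cone i n) (a : Fin 3) :
    0 ≤ v a := by
  obtain ⟨w, hw, rfl⟩ := cone_antitone i n.zero_le h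
  simpa [prodMat_zero] using hw a

theorem smul_mem_cone {i : Seq} {n : ℕ} {v : Fin 3 → ℝ} (h : v ∈ cone i n) {c : ℝ} (hc : 0 ≤ c) :
    c • v ∈ cone i n := by
  obtain ⟨w, hw, rfl⟩ := h
  exact ⟨c • w, fun a => mul_nonneg hc (hw a), Matrix.mulVec_smul _ _ _⟩

theorem isClosed_cone (i : Seq) (n : ℕ) : IsClosed (cone i n) := by
  have hu := (Matrix.isUnit_iff_isUnit_det _).1 (isUnit_prodMat i n)
  have e : cone i n = ⋂ a, {v | 0 ≤ ((prodMat i n)⁻¹ *ᵥ v) a} := by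
    ext v
    simp only [cone, mem_image, mem_iInter, mem_ofPred_eq]
    constructor
    · rintro ⟨w, hw, rfl⟩ a
      rw [Matrix.mulVec_mulVec, Matrix.nonsing_inv_mul _ hu, Matrix.one_mulVec]
      exact hw a
    · intro h
      exact ⟨_, h, by rw [Matrix.mulVec_mulVec, Matrix.mul_nonsing_inv _ hu, Matrix.one_mulVec]⟩
  rw [e]
  refine isClosed_iInter fun a => isClosed_le continuous_const ?_
  fun_prop

theorem one_le_colSum (i : Seq) (n : ℕ) (j : Fin 3) : 1 ≤ ((1 : Fin 3 → ℝ) ᵥ* prodMat i n) j :=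
  (driven_vecMul i 1).one_le (fun j => by simp [prodMat_zero]) n j

theorem sum_mulVec (A : Matrix (Fin 3) (Fin 3) ℝ) (v : Fin 3 → ℝ) :
    ∑ a, (A *ᵥ v) a = ((1 : Fin 3 → ℝ) ᵥ* A) ⬝ᵥ v := by
  rw [← Matrix.dotProduct_mulVec, one_dotProduct]

/-- A point of the section is a convex combination of the normalized columns, so `osc` bounds the
spread of each coordinate over the section. -/
theorem ratio_le_of_mem_cone {i : Seq} {n : ℕ} {v : Fin 3 → ℝ} (h : v ∈ cone i n)
    (hs : ∑ a, v a = 1) (a : Fin 3) :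
    v a ≤ top (fun j => prodMat i n a j / ((1 : Fin 3 → ℝ) ᵥ* prodMat i n) j) ∧
    -v a ≤ top (fun j => -(prodMat i n a j / ((1 : Fin 3 → ℝ) ᵥ* prodMat i n) j)) := by
  obtain ⟨w, hw, rfl⟩ := h
  simp only at hs ⊢
  rw [sum_mulVec] at hs
  set l := (1 : Fin 3 → ℝ) ᵥ* prodMat i n with hl
  have lpos : ∀ j, 0 < l j := fun j => zero_lt_one.trans_le (one_le_colSum i n j)
  constructor
  · set t := top (fun j => prodMat i n a j / l j) with ht
    calc (prodMat i n *ᵥ w) a = ∑ j, prodMat i n a j * w j := rfl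
      _ ≤ ∑ j, t * (l j * w j) := by
        refine Finset.sum_le_sum fun j _ => ?_
        rw [← mul_assoc]
        refine mul_le_mul_of_nonneg_right ?_ (hw j)
        rw [← div_le_iff₀ (lpos j)]
        exact le_top (fun j => prodMat i n a j / l j) j
      _ = t := by rw [← Finset.mul_sum]; exact (congrArg _ hs).trans (mul_one t)
  · set t := top (fun j => -(prodMat i n a j / l j)) with ht
    calc -(prodMat i n *ᵥ w) a = ∑ j, -(prodMat i n a j * w j) := by
          rw [Finset.sum_neg_distrib]; rfl
      _ ≤ ∑ j, t * (l j * w j) := by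
        refine Finset.sum_le_sum fun j _ => ?_
        rw [← mul_assoc, ← neg_mul]
        refine mul_le_mul_of_nonneg_right ?_ (hw j)
        rw [← div_le_iff₀ (lpos j), neg_div]
        exact le_top (fun j => -(prodMat i n a j / l j)) j
      _ = t := by rw [← Finset.mul_sum]; exact (congrArg _ hs).trans (mul_one t)

/-- The sections of the cones shrink to a point. -/
theorem exists_cone_small (i : Seq) {d : ℝ} (hd : 0 < d) :
    ∃ n, ∀ v ∈ cone i n, ∀ w ∈ cone i n, ∑ a, v a = 1 → ∑ a, w a = 1 → ∀ a, v a - w a < d := by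
  have h : ∀ a, ∃ n, osc ((1 : Fin 3 → ℝ) ᵥ* prodMat i n) (prodMat i n a) < d := fun a =>
    exists_osc_lt (driven_vecMul i 1) (driven_row i a) (fun j => by simp [prodMat_zero]) hd
  choose N hN using h
  refine ⟨∑ a, N a, fun v hv w hw sv sw a => ?_⟩
  have hle : N a ≤ ∑ a, N a := Finset.single_le_sum (fun _ _ => Nat.zero_le _) (Finset.mem_univ a)
  have h1 := (ratio_le_of_mem_cone (cone_antitone i hle hv) sv a).1
  have h2 := (ratio_le_of_mem_cone (cone_antitone i hle hw) sw a).2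
  have h3 := hN a
  unfold osc at h3
  linarith

theorem simplex_eq_of_mem_limitCone {i : Seq} {x y : Simplex} (hx : x.1 ∈ limitCone i)
    (hy : y.1 ∈ limitCone i) : x = y := by
  have key : ∀ {x y : Simplex}, x.1 ∈ limitCone i → y.1 ∈ limitCone i → ∀ a, x.1 a ≤ y.1 a := by
    intro x y hx hy a
    refine le_of_forall_pos_lt_add fun d hd => ?_
    obtain ⟨n, hn⟩ := exists_cone_small i hd
    have := hn _ (mem_limitCone.1 hx n) _ (mem_limitCone.1 hy n) x.2.2 y.2.2 a
    linarith
  exact Subtype.ext (funext fun a => le_antisymm (key hx hy a) (key hy hx a))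

theorem column_mem_cone (i : Seq) (n : ℕ) (j : Fin 3) :
    (fun a => prodMat i n a j / ((1 : Fin 3 → ℝ) ᵥ* prodMat i n) j) ∈ cone i n := by
  refine ⟨Pi.single j (((1 : Fin 3 → ℝ) ᵥ* prodMat i n) j)⁻¹, fun a => ?_, ?_⟩
  · have := zero_lt_one.trans_le (one_le_colSum i n j)
    by_cases h : a = j
    · subst h; simp [this.le]
    · simp [h]
  · funext a
    simp [Matrix.mulVec_single, div_eq_mul_inv]

theorem column_sum (i : Seq) (n : ℕ) (j : Fin 3) :
    ∑ a, prodMat i n a j / ((1 : Fin 3 → ℝ) ᵥ* prodMat i n) j = 1 := by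
  have := zero_lt_one.trans_le (one_le_colSum i n j)
  rw [← Finset.sum_div, div_eq_one_iff_eq this.ne', Matrix.vecMul, one_dotProduct]

theorem exists_mem_limitCone (i : Seq) : ∃ x : Simplex, x.1 ∈ limitCone i := by
  have hc : ∀ n, IsClosed {x : Simplex | x.1 ∈ cone i n} := fun n =>
    (isClosed_cone i n).preimage continuous_subtype_val
  have := IsCompact.nonempty_iInter_of_sequence_nonempty_isCompact_isClosed
    (fun n => {x : Simplex | x.1 ∈ cone i n}) (fun n x hx => cone_succ_subset i n hx)
    (fun n => ⟨⟨_, nonneg_of_mem_cone (column_mem_cone i n 0), column_sum i n 0⟩,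
      column_mem_cone i n 0⟩) (hc 0).isCompact hc
  obtain ⟨x, hx⟩ := this
  exact ⟨x, mem_limitCone.2 fun n => mem_iInter.1 hx n⟩

theorem limitCone_eq_ray {i : Seq} {x : Simplex} (hx : x.1 ∈ limitCone i) :
    limitCone i = ray x.1 := by
  ext v
  constructor
  · intro hv
    have v0 : ∀ a, 0 ≤ v a := nonneg_of_mem_cone (mem_limitCone.1 hv 0)
    rcases (Finset.sum_nonneg fun a _ => v0 a : 0 ≤ ∑ a, v a).eq_or_lt with h | h
    · refine ⟨0, le_rfl, ?_⟩
      rw [zero_smul]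
      funext a
      exact (Finset.sum_eq_zero_iff_of_nonneg fun a _ => v0 a).1 h.symm a (Finset.mem_univ a)
    · refine ⟨∑ a, v a, h.le, ?_⟩
      have hm : (∑ a, v a)⁻¹ • v ∈ limitCone i := mem_limitCone.2 fun n =>
        smul_mem_cone (mem_limitCone.1 hv n) (inv_nonneg.2 h.le)
      let y : Simplex := ⟨(∑ a, v a)⁻¹ • v, nonneg_of_mem_cone (mem_limitCone.1 hm 0), by
        simp only [Pi.smul_apply, smul_eq_mul, ← Finset.mul_sum]
        exact inv_mul_cancel₀ h.ne'⟩
      have : y = x := simplex_eq_of_mem_limitCone hm hx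
      rw [← this]
      change v = (∑ a, v a) • (∑ a, v a)⁻¹ • v
      rw [smul_smul, mul_inv_cancel₀ h.ne', one_smul]
  · rintro ⟨c, hc, rfl⟩
    exact mem_limitCone.2 fun n => smul_mem_cone (mem_limitCone.1 hx n) hc

theorem limitCone_eq_ray_proj (i : Seq) : limitCone i = ray (proj i).1 := by
  obtain ⟨x, hx⟩ := exists_mem_limitCone i
  exact Classical.epsilon_spec (p := fun x : Simplex => limitCone i = ray x.1)
    ⟨x, limitCone_eq_ray hx⟩

theorem proj_mem_limitCone (i : Seq) : (proj i).1 ∈ limitCone i := by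
  rw [limitCone_eq_ray_proj]
  exact ⟨1, zero_le_one, (one_smul _ _).symm⟩

theorem proj_eq_of_mem {i : Seq} {x : Simplex} (hx : x.1 ∈ limitCone i) : proj i = x :=
  simplex_eq_of_mem_limitCone (proj_mem_limitCone i) hx

theorem prodMat_congr {i j : Seq} {n : ℕ} (h : ∀ k < n, i k = j k) : prodMat i n = prodMat j n := by
  induction n with
  | zero => simp [prodMat_zero]
  | succ n ih => rw [prodMat_succ, prodMat_succ, ih fun k hk => h k (hk.trans n.lt_succ_self),
      h n n.lt_succ_self]

theorem isOpen_prefix (i : Seq) (n : ℕ) : IsOpen {j : Seq | ∀ k < n, j k = i k} := by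
  have : {j : Seq | ∀ k < n, j k = i k} = ⋂ k ∈ Finset.range n, {j | j k = i k} := by
    ext; simp
  rw [this]
  refine isOpen_biInter_finset fun k _ => ?_
  have hk : Continuous fun j : Seq => j k := continuous_apply k
  exact (isOpen_discrete ({i k} : Set (Fin 2))).preimage hk

/-- Sequences with a long common prefix share a cone, and its section is small. -/
theorem continuous_proj : Continuous proj := by
  refine continuous_induced_rng.2 (continuous_pi fun a => continuous_iff_continuousAt.2 fun i => ?_)
  refine Metric.tendsto_nhds.2 fun d hd => ?_
  obtain ⟨n, hn⟩ := exists_cone_small i hd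
  filter_upwards [(isOpen_prefix i n).mem_nhds (fun k _ => rfl)] with j hj
  have hi := mem_limitCone.1 (proj_mem_limitCone i) n
  have hj' := mem_limitCone.1 (proj_mem_limitCone j) n
  unfold cone at hj'
  rw [prodMat_congr hj] at hj'
  change dist ((proj j).1 a) ((proj i).1 a) < d
  rw [Real.dist_eq, abs_lt]
  constructor
  · linarith [hn _ hi _ hj' (proj i).2.2 (proj j).2.2 a]
  · exact hn _ hj' _ hi (proj j).2.2 (proj i).2.2 a

/-- Once the section is smaller than the least coordinate of `proj i`, the normalized columns, which
lie in it, cannot have a zero entry. -/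
theorem prodMat_pos_of_proj_pos {i : Seq} (h : ∀ a, 0 < (proj i).1 a) :
    ∃ n, ∀ a b, 0 < prodMat i n a b := by
  obtain ⟨d, hd, hda⟩ : ∃ d, 0 < d ∧ ∀ a, d ≤ (proj i).1 a := by
    obtain ⟨a, ha⟩ := Finite.exists_min (proj i).1
    exact ⟨_, h a, ha⟩
  obtain ⟨n, hn⟩ := exists_cone_small i hd
  refine ⟨n, fun a b => ?_⟩
  have h1 := hn _ (mem_limitCone.1 (proj_mem_limitCone i) n) _ (column_mem_cone i n b)
    (proj i).2.2 (column_sum i n b) a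
  have h2 : 0 < prodMat i n a b / ((1 : Fin 3 → ℝ) ᵥ* prodMat i n) b := by linarith [hda a]
  exact (div_pos_iff_of_pos_right (zero_lt_one.trans_le (one_le_colSum i n b))).1 h2

/-! ### Coding of points and total irrationality -/

theorem C_mulVec_F (x : Fin 3 → ℝ) : C (if x 2 ≤ x 0 then 0 else 1) *ᵥ F x = x := by
  unfold F
  split_ifs with h
  · rw [C_zero_mulVec]; funext a; fin_cases a <;> simp
  · rw [C_one_mulVec]; funext a; fin_cases a <;> simp

theorem coding_f (x : Simplex) : coding (f x) = shift (coding x) := rfl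

theorem coding_iterate (x : Simplex) (r : ℕ) : coding (f^[r] x) = shift^[r] (coding x) := by
  induction r with
  | zero => rfl
  | succ r ih => rw [Function.iterate_succ_apply', coding_f, ih, Function.iterate_succ_apply']

theorem F_eq_smul (x : Simplex) : F x.1 = l1 (F x.1) • (f x).1 := by
  funext a
  exact (mul_div_cancel₀ _ (l1_F_pos x).ne').symm

theorem mem_cone_succ {i : Seq} {n : ℕ} {v : Fin 3 → ℝ} :
    v ∈ cone i (n + 1) ↔ ∃ w ∈ cone (shift i) n, C (i 0) *ᵥ w = v := by
  simp only [cone, mem_image, prodMat_succ']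
  constructor
  · rintro ⟨w, hw, rfl⟩
    exact ⟨_, ⟨w, hw, rfl⟩, by rw [Matrix.mulVec_mulVec]⟩
  · rintro ⟨_, ⟨w, hw, rfl⟩, rfl⟩
    exact ⟨w, hw, by rw [Matrix.mulVec_mulVec]⟩

theorem mem_cone_coding (x : Simplex) (n : ℕ) : x.1 ∈ cone (coding x) n := by
  induction n generalizing x with
  | zero => exact ⟨x.1, x.2.1, by simp [prodMat_zero]⟩
  | succ n ih =>
    refine mem_cone_succ.2 ⟨F x.1, ?_, C_mulVec_F x.1⟩
    rw [← coding_f, F_eq_smul]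
    exact smul_mem_cone (ih (f x)) (l1_F_pos x).le

theorem proj_coding (x : Simplex) : proj (coding x) = x :=
  proj_eq_of_mem (mem_limitCone.2 (mem_cone_coding x))

theorem mem_irrationalVectors {x : Simplex} :
    x ∈ irrationalVectors ↔ ∀ z : Fin 3 → ℤ, ∑ a, (z a : ℝ) * x.1 a = 0 → z = 0 := by
  change LinearIndependent ℚ (fun a => x.1 a) ↔ _
  rw [← LinearIndependent.iff_fractionRing ℤ ℚ, Fintype.linearIndependent_iff]
  simp only [zsmul_eq_mul, funext_iff, Pi.zero_apply]

theorem pos_of_mem_irrationalVectors {x : Simplex} (hx : x ∈ irrationalVectors) (a : Fin 3) :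
    0 < x.1 a := by
  refine lt_of_le_of_ne (x.2.1 a) fun h => ?_
  have := mem_irrationalVectors.1 hx (Pi.single a 1) (by simp [Pi.single_apply, ← h])
  have := congrFun this a
  simp at this

theorem f_mem_irrationalVectors {x : Simplex} (hx : x ∈ irrationalVectors) :
    f x ∈ irrationalVectors := by
  rw [mem_irrationalVectors] at hx ⊢
  intro z hz
  have h1 : ∑ a, (z a : ℝ) * F x.1 a = 0 := by
    have : ∑ a, (z a : ℝ) * F x.1 a = l1 (F x.1) * ∑ a, (z a : ℝ) * (f x).1 a := by
      rw [F_eq_smul, Finset.mul_sum]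
      refine Finset.sum_congr rfl fun a _ => ?_
      rw [Pi.smul_apply, smul_eq_mul, ← F_eq_smul]
      ring
    rw [this, hz, mul_zero]
  rw [Fin.sum_univ_three] at h1
  unfold F at h1
  split_ifs at h1 with h
  -- The coefficients of `z · F x`, rewritten as an integer combination of the entries of `x`.
  · have := hx ![z 0, z 2, z 1 - z 0] (by
      rw [Fin.sum_univ_three]; simp at h1 ⊢; linarith)
    have h0 := congrFun this 0
    have h2 := congrFun this 1
    have h3 := congrFun this 2
    simp at h0 h2 h3
    funext a
    fin_cases a <;> simp <;> omega
  · have := hx ![z 1 - z 2, z 0, z 2] (by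
      rw [Fin.sum_univ_three]; simp at h1 ⊢; linarith)
    have h0 := congrFun this 0
    have h2 := congrFun this 1
    have h3 := congrFun this 2
    simp at h0 h2 h3
    funext a
    fin_cases a <;> simp <;> omega

theorem coding_mem_primitiveSeqs {x : Simplex} (hx : x ∈ irrationalVectors) :
    coding x ∈ primitiveSeqs := by
  rw [mem_primitiveSeqs]
  intro r
  rw [← coding_iterate]
  refine prodMat_pos_of_proj_pos ?_
  rw [proj_coding]
  refine pos_of_mem_irrationalVectors ?_
  induction r with
  | zero => exact hx
  | succ r ih => rw [Function.iterate_succ_apply']; exact f_mem_irrationalVectors ih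

/-! ### The coding inverts `π` on primitive sequences -/

theorem pos_of_mem_cone {i : Seq} {k : ℕ} (h : ∀ a b, 0 < prodMat i k a b) {v : Fin 3 → ℝ}
    (hv : v ∈ cone i k) (hv0 : v ≠ 0) (a : Fin 3) : 0 < v a := by
  obtain ⟨w, hw, rfl⟩ := hv
  have hw0 : ∃ b, w b ≠ 0 := by
    by_contra! hcon
    exact hv0 (by simp only [show w = 0 from funext hcon, Matrix.mulVec_zero])
  obtain ⟨b, hb⟩ := hw0
  exact Finset.sum_pos' (fun c _ => mul_nonneg (h a c).le (hw c))
    ⟨b, Finset.mem_univ b, mul_pos (h a b) (lt_of_le_of_ne (hw b) hb.symm)⟩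

theorem simplex_ne_zero (x : Simplex) : x.1 ≠ 0 := by
  intro h
  have := x.2.2
  rw [h] at this
  simp at this

theorem mulVec_injective_of_isUnit {A : Matrix (Fin 3) (Fin 3) ℝ} (h : IsUnit A) :
    Function.Injective (A *ᵥ ·) :=
  Matrix.mulVec_injective_iff_isUnit.2 h

/-- Injectivity of `C (i 0)` makes the preimage of `proj i` the same at every level. Positivity of
`w` comes from a positive block starting at index one; it is what makes the first letter readable.
-/
theorem exists_unfold {i : Seq} (hi : i ∈ primitiveSeqs) :
    ∃ w : Fin 3 → ℝ, (∀ a, 0 < w a) ∧ w ∈ limitCone (shift i) ∧ C (i 0) *ᵥ w = (proj i).1 := by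
  have h := fun n => mem_cone_succ.1 (mem_limitCone.1 (proj_mem_limitCone i) (n + 1))
  obtain ⟨w, -, hw⟩ := h 0
  have hmem : ∀ n, w ∈ cone (shift i) n := by
    intro n
    obtain ⟨w', hw', e⟩ := h n
    have : w' = w := mulVec_injective_of_isUnit (isUnit_C (i 0)) (e.trans hw.symm)
    rwa [← this]
  obtain ⟨k, hk⟩ := mem_primitiveSeqs.1 hi 1
  refine ⟨w, pos_of_mem_cone hk (hmem k) ?_, mem_limitCone.2 hmem, hw⟩
  rintro rfl
  exact simplex_ne_zero (proj i) (by rw [← hw, Matrix.mulVec_zero])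

theorem coding_proj_zero {i : Seq} (hi : i ∈ primitiveSeqs) : coding (proj i) 0 = i 0 := by
  obtain ⟨w, hw, -, e⟩ := exists_unfold hi
  change (if (proj i).1 2 ≤ (proj i).1 0 then (0 : Fin 2) else 1) = i 0
  rw [← e]
  have := hw 0
  have := hw 2
  rcases fin_two_cases (i 0) with h | h <;> rw [h]
  · rw [C_zero_mulVec, if_pos]; simp; linarith
  · rw [C_one_mulVec, if_neg]; simp; linarith

theorem proj_shift {i : Seq} (hi : i ∈ primitiveSeqs) : proj (shift i) = f (proj i) := by
  obtain ⟨w, hw, hm, e⟩ := exists_unfold hi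
  have h0 : C (i 0) *ᵥ F (proj i).1 = (proj i).1 := by
    rw [← coding_proj_zero hi]
    exact C_mulVec_F _
  have : F (proj i).1 = w := mulVec_injective_of_isUnit (isUnit_C (i 0)) (h0.trans e.symm)
  refine proj_eq_of_mem ?_
  have e2 : (f (proj i)).1 = (l1 (F (proj i).1))⁻¹ • w := by
    rw [← this]
    funext a
    exact div_eq_inv_mul _ _
  rw [e2]
  exact mem_limitCone.2 fun n =>
    smul_mem_cone (mem_limitCone.1 hm n) (inv_nonneg.2 (l1_F_pos _).le)

theorem coding_proj {i : Seq} (hi : i ∈ primitiveSeqs) : coding (proj i) = i := by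
  funext n
  induction n generalizing i with
  | zero => exact coding_proj_zero hi
  | succ n ih =>
    have := ih (shift_mem_primitiveSeqs hi)
    rw [proj_shift hi, coding_f] at this
    exact this

/-! ### Integer row vectors that keep mixed signs -/

/-- A vector with entries of both signs. -/
def Mixed (v : Fin 3 → ℤ) : Prop :=
  (0 < v 0 ∨ 0 < v 1 ∨ 0 < v 2) ∧ (v 0 < 0 ∨ v 1 < 0 ∨ v 2 < 0)

/-- The oscillation of an integer row vector over the current columns and the next one. -/
def width (v : Fin 3 → ℤ) : ℤ :=
  max (max (v 0) (v 1)) (max (v 2) (v 0 + v 2)) - min (min (v 0) (v 1)) (min (v 2) (v 0 + v 2))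

/-- The outer entries have strictly opposite signs. -/
def Opp (v : Fin 3 → ℤ) : Prop := (0 < v 0 ∧ v 2 < 0) ∨ (v 0 < 0 ∧ 0 < v 2)

/-- The outer entries have strictly the same sign. -/
def Same (v : Fin 3 → ℤ) : Prop := (0 < v 0 ∧ 0 < v 2) ∨ (v 0 < 0 ∧ v 2 < 0)

theorem width_nonneg (v : Fin 3 → ℤ) : 0 ≤ width v := by
  unfold width
  omega

/-- For `c = 0`, `v 2` is dropped and `v 0 + v 1` enters. If this widens the range, `v 0` and `v 1`
have the same sign, so mixedness leaves `v 0 + v 2` alone on the other side; there the range loses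
`|v 0|`, at least the gain `min |v 0| |v 1|`. The case `c = 1` is symmetric. -/
theorem width_step_le {v : Fin 3 → ℤ} (c : Fin 2) (hm : Mixed (step c v)) :
    width (step c v) ≤ width v := by
  rcases fin_two_cases c with rfl | rfl <;> simp [Mixed, width, step_zero, step_one] at * <;> omega

theorem same_or_opp_or_width_lt {v : Fin 3 → ℤ} (c : Fin 2) (hv : Opp v)
    (hm : Mixed (step c v)) :
    Same (step c v) ∨ Opp (step c v) ∨ width (step c v) < width v := by
  rcases fin_two_cases c with rfl | rfl <;> rcases hv with hv | hv <;>
    simp [Mixed, width, step_zero, step_one, Same, Opp] at * <;> omega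

/-- The dropped outer entry was strictly beyond the sum `v 0 + v 2`; for the width to survive, the
old middle entry, now outer, must be at least as extreme. -/
theorem middle_lt_of_opp {v : Fin 3 → ℤ} (c : Fin 2) (hv : Opp v) (h : Opp (step c v))
    (hw : width (step c v) = width v) :
    step c v 1 < max (step c v 0) (step c v 2) ∧ min (step c v 0) (step c v 2) < step c v 1 := by
  rcases fin_two_cases c with rfl | rfl <;> rcases hv with hv | hv <;>
    simp [width, step_zero, step_one, Opp] at * <;> omega

theorem width_step_lt {v : Fin 3 → ℤ} (c : Fin 2) (hv : Opp v)
    (h : v 1 < max (v 0) (v 2) ∧ min (v 0) (v 2) < v 1) (hm : Mixed (step c v)) :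
    width (step c v) < width v := by
  rcases fin_two_cases c with rfl | rfl <;> rcases hv with hv | hv <;>
    simp [Mixed, width, step_zero, step_one] at * <;> omega

/-- Two consecutive `Opp` vectors would cost width by the next letter. -/
theorem same_step_of_opp {v : Fin 3 → ℤ} {c d : Fin 2} (hv : Opp v)
    (hv' : Mixed (step c v)) (hv'' : Mixed (step d (step c v))) (h1 : width (step c v) = width v)
    (h2 : width (step d (step c v)) = width v) : Same (step c v) := by
  rcases same_or_opp_or_width_lt c hv hv' with h | h | h
  · exact h
  · have := width_step_lt d h (middle_lt_of_opp c hv h h1) hv''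
    omega
  · omega

/-- The middle entry has the opposite sign and moves to an outer place beside a surviving outer
entry. -/
theorem opp_step_of_same {v : Fin 3 → ℤ} (c : Fin 2) (hv : Same v) (hm : Mixed v) :
    Opp (step c v) := by
  rcases fin_two_cases c with rfl | rfl <;>
    simp [Mixed, step_zero, step_one, Same, Opp] at * <;> omega

theorem eq_of_same {v : Fin 3 → ℤ} {c d : Fin 2} (hv : Same v) (hm : Mixed v)
    (h : Same (step d (step c v))) : c = d := by
  rcases fin_two_cases c with rfl | rfl <;> rcases fin_two_cases d with rfl | rfl <;>
    simp [Mixed, step_zero, step_one, Same] at * <;> omega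

theorem letter_of_not_opp {v : Fin 3 → ℤ} {c : Fin 2} (hm : Mixed v)
    (h : ¬ Opp (step c v)) : (v 0 = 0 → c = 0 ∧ step c v 0 = 0) ∧
      (v 2 = 0 → c = 1 ∧ step c v 2 = 0) := by
  rcases fin_two_cases c with rfl | rfl <;> simp [Mixed, step_zero, step_one, Opp] at * <;> omega

/-- If an integer row vector keeps entries of both signs forever, then the letters eventually
come in pairs. -/
theorem exists_paired_of_mixed {i : Seq} {z : ℕ → Fin 3 → ℤ} (Z : Driven i z)
    (hm : ∀ n, Mixed (z n)) : ∃ n, ∀ m, i (n + 2 * m) = i (n + 2 * m + 1) := by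
  obtain ⟨n₀, hn₀⟩ : ∃ n₀, ∀ n, n₀ ≤ n → width (z n) = width (z n₀) := by
    have hanti : Antitone fun n => width (z n) := antitone_nat_of_succ_le fun n => by
      have h := hm (n + 1)
      rw [Z n] at h ⊢
      exact width_step_le _ h
    obtain ⟨n₀, h⟩ : ∃ n₀, ∀ n, (width (z n₀)).toNat ≤ (width (z n)).toNat :=
      ⟨_, fun n => Function.argmin_le (fun n => (width (z n)).toNat) n⟩
    refine ⟨n₀, fun n hn => le_antisymm (hanti hn) ?_⟩
    have := h n
    have := width_nonneg (z n)
    have := width_nonneg (z n₀)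
    omega
  have hO : ∀ n, n₀ ≤ n → Opp (z n) → Same (z (n + 1)) := by
    intro n hn ho
    have m1 := hm (n + 1)
    have m2 := hm (n + 2)
    have w1 := (hn₀ (n + 1) (by omega)).trans (hn₀ n hn).symm
    have w2 := (hn₀ (n + 2) (by omega)).trans (hn₀ n hn).symm
    rw [Z (n + 1)] at m2 w2
    rw [Z n] at m1 m2 w1 w2 ⊢
    exact same_step_of_opp ho m1 m2 w1 w2
  by_cases hS : ∃ n, n₀ ≤ n ∧ Same (z n)
  · obtain ⟨n, hn, hs⟩ := hS
    have step2 : ∀ n, n₀ ≤ n → Same (z n) → Same (z (n + 2)) := by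
      intro n hn hs
      refine hO (n + 1) (by omega) ?_
      rw [Z n]
      exact opp_step_of_same _ hs (hm n)
    have all : ∀ m, Same (z (n + 2 * m)) := by
      intro m
      induction m with
      | zero => exact hs
      | succ m ih => exact step2 (n + 2 * m) (by omega) ih
    refine ⟨n, fun m => ?_⟩
    have h := step2 _ (by omega) (all m)
    rw [Z (n + 2 * m + 1), Z (n + 2 * m)] at h
    exact eq_of_same (all m) (hm _) h
  · push Not at hS
    have hO' : ∀ n, n₀ ≤ n → ¬ Opp (z n) := fun n hn ho => hS (n + 1) (by omega) (hO n hn ho)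
    have hl : ∀ n, n₀ ≤ n → (z n 0 = 0 → i n = 0 ∧ z (n + 1) 0 = 0) ∧
        (z n 2 = 0 → i n = 1 ∧ z (n + 1) 2 = 0) := by
      intro n hn
      have h := hO' (n + 1) (by omega)
      rw [Z n] at h ⊢
      exact letter_of_not_opp (hm n) h
    -- Neither `Same` nor `Opp` forces a zero outer entry, which then persists and makes the letters
    -- constant.
    have h0 : z n₀ 0 = 0 ∨ z n₀ 2 = 0 := by
      have a := hS n₀ le_rfl
      have b := hO' n₀ le_rfl
      unfold Same at a
      unfold Opp at b
      omega
    refine ⟨n₀, fun m => ?_⟩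
    rcases h0 with h0 | h0
    · have all : ∀ k, z (n₀ + k) 0 = 0 := by
        intro k
        induction k with
        | zero => exact h0
        | succ k ih => exact ((hl _ (by omega)).1 ih).2
      exact ((hl _ (by omega)).1 (all (2 * m))).1.trans
        ((hl _ (by omega)).1 (all (2 * m + 1))).1.symm
    · have all : ∀ k, z (n₀ + k) 2 = 0 := by
        intro k
        induction k with
        | zero => exact h0
        | succ k ih => exact ((hl _ (by omega)).2 ih).2
      exact ((hl _ (by omega)).2 (all (2 * m))).1.trans
        ((hl _ (by omega)).2 (all (2 * m + 1))).1.symm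

/-- Each pair of equal letters returns the middle row to `![0, 1, 0]`, and halfway through a pair it
is still a unit vector, so no block starting at `n` is positive. -/
theorem not_mem_primitiveSeqs_of_paired {i : Seq} {n : ℕ}
    (h : ∀ m, i (n + 2 * m) = i (n + 2 * m + 1)) : i ∉ primitiveSeqs := by
  intro hi
  obtain ⟨k, hk⟩ := mem_primitiveSeqs.1 hi n
  have D : ∀ m, prodMat (shift^[n] i) (m + 1) 1 =
      step ((shift^[n] i) m) (prodMat (shift^[n] i) m 1) := driven_row (shift^[n] i) 1
  have hs : ∀ m, (shift^[n] i) (2 * m) = (shift^[n] i) (2 * m + 1) := by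
    intro m
    rw [shift_iterate, shift_iterate, add_comm, h m]
    congr 1
    omega
  have even : ∀ m, prodMat (shift^[n] i) (2 * m) 1 = ![0, 1, 0] := by
    intro m
    induction m with
    | zero => rw [mul_zero, prodMat_zero]; funext a; fin_cases a <;> simp [Matrix.one_apply]
    | succ m ih =>
      have e := D (2 * m + 1)
      rw [D (2 * m), ih, ← hs m] at e
      rw [mul_add, mul_one]
      refine e.trans ?_
      rcases fin_two_cases ((shift^[n] i) (2 * m)) with h' | h' <;> rw [h'] <;>
        simp [step_zero, step_one]
  obtain ⟨m, rfl | rfl⟩ := Nat.even_or_odd' k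
  · have := hk 1 0
    rw [even m] at this
    simp at this
  · have e := D (2 * m)
    rw [even m] at e
    rcases fin_two_cases ((shift^[n] i) (2 * m)) with h' | h' <;> rw [h'] at e
    · have := hk 1 0
      rw [e] at this
      simp [step_zero] at this
    · have := hk 1 2
      rw [e] at this
      simp [step_one] at this

/-! ### Primitive sequences project to totally irrational vectors -/

/-- The orbit of an integer row vector. -/
def intOrbit (i : Seq) (z : Fin 3 → ℤ) : ℕ → Fin 3 → ℤ
  | 0 => z
  | n + 1 => step (i n) (intOrbit i z n)

theorem driven_intOrbit (i : Seq) (z : Fin 3 → ℤ) : Driven i (intOrbit i z) := fun _ => rfl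

theorem intOrbit_cast (i : Seq) (z : Fin 3 → ℤ) (n : ℕ) :
    (fun a => (intOrbit i z n a : ℝ)) = (fun a => (z a : ℝ)) ᵥ* prodMat i n := by
  induction n with
  | zero => simp [prodMat_zero, intOrbit]
  | succ n ih =>
    rw [prodMat_succ, ← Matrix.vecMul_vecMul, vecMul_C, ← ih, intOrbit]
    rcases fin_two_cases (i n) with h | h <;> rw [h] <;> funext a <;> fin_cases a <;>
      simp [step_zero, step_one]

theorem intOrbit_ne_zero (i : Seq) {z : Fin 3 → ℤ} (hz : z ≠ 0) (n : ℕ) : intOrbit i z n ≠ 0 := by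
  induction n with
  | zero => exact hz
  | succ n ih =>
    contrapose! ih
    rw [intOrbit] at ih
    have h0 := congrFun ih 0
    have h1 := congrFun ih 1
    have h2 := congrFun ih 2
    rcases fin_two_cases (i n) with h | h <;> rw [h] at h0 h1 h2 <;>
      simp [step_zero, step_one] at h0 h1 h2 <;> funext a <;> fin_cases a <;> simp <;> omega

theorem mixed_of_dotProduct_eq_zero {v : Fin 3 → ℤ} (hv : v ≠ 0) {w : Fin 3 → ℝ}
    (hw : ∀ a, 0 < w a) (h : ∑ a, (v a : ℝ) * w a = 0) : Mixed v := by
  have hex : v 0 ≠ 0 ∨ v 1 ≠ 0 ∨ v 2 ≠ 0 := by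
    by_contra! hcon
    exact hv (funext fun a => by fin_cases a <;> simp [hcon])
  constructor
  · by_contra! hcon
    have hle : ∀ a, v a ≤ 0 := fun a => by fin_cases a <;> simp [hcon]
    have hz := (Finset.sum_eq_zero_iff_of_nonpos fun a _ => mul_nonpos_of_nonpos_of_nonneg
      (Int.cast_nonpos.2 (hle a)) (hw a).le).1 h
    refine hv (funext fun a => ?_)
    simpa [(hw a).ne'] using hz a (Finset.mem_univ a)
  · by_contra! hcon
    have hle : ∀ a, 0 ≤ v a := fun a => by fin_cases a <;> simp [hcon]
    have hz := (Finset.sum_eq_zero_iff_of_nonneg fun a _ => mul_nonneg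
      (Int.cast_nonneg (hle a)) (hw a).le).1 h
    refine hv (funext fun a => ?_)
    simpa [(hw a).ne'] using hz a (Finset.mem_univ a)

theorem proj_mem_irrationalVectors {i : Seq} (hi : i ∈ primitiveSeqs) :
    proj i ∈ irrationalVectors := by
  rw [mem_irrationalVectors]
  intro z hz
  by_contra hz0
  have hmixed : ∀ n, Mixed (intOrbit i z n) := by
    intro n
    obtain ⟨k, hk⟩ := mem_primitiveSeqs.1 hi n
    obtain ⟨g, hg, e⟩ := mem_limitCone.1 (proj_mem_limitCone i) (n + k)
    simp only at e
    rw [prodMat_add, ← Matrix.mulVec_mulVec] at e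
    -- The point `proj i` pulled back through `n` letters; the positive block of length `k` makes it
    -- positive, and the transported relation annihilates it.
    set w := prodMat (shift^[n] i) k *ᵥ g with hw
    have hw0 : w ≠ 0 := by
      intro h0
      rw [h0, Matrix.mulVec_zero] at e
      exact simplex_ne_zero _ e.symm
    refine mixed_of_dotProduct_eq_zero (intOrbit_ne_zero i hz0 n)
      (pos_of_mem_cone hk ⟨g, hg, rfl⟩ hw0) ?_
    change (fun a => (intOrbit i z n a : ℝ)) ⬝ᵥ w = 0
    rw [intOrbit_cast, ← Matrix.dotProduct_mulVec, e]
    exact hz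
  obtain ⟨n, hn⟩ := exists_paired_of_mixed (driven_intOrbit i z) hmixed
  exact not_mem_primitiveSeqs_of_paired hn hi

theorem bijOn_proj : BijOn proj primitiveSeqs irrationalVectors :=
  ⟨fun _ hi => proj_mem_irrationalVectors hi,
    fun i hi j hj h => by rw [← coding_proj hi, h, coding_proj hj],
    fun x hx => ⟨coding x, coding_mem_primitiveSeqs hx, proj_coding x⟩⟩

/-! ### Measurability and isomorphism of systems -/

theorem measurable_shift : Measurable shift :=
  measurable_pi_lambda _ fun n => measurable_pi_apply (n + 1)

theorem measurable_F : Measurable F := by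
  have h : MeasurableSet {x : Fin 3 → ℝ | x 2 ≤ x 0} :=
    measurableSet_le (measurable_pi_apply 2) (measurable_pi_apply 0)
  unfold F
  refine Measurable.ite h ?_ ?_ <;> refine measurable_pi_lambda _ fun a => ?_ <;>
    fin_cases a <;> simp <;> fun_prop

theorem measurable_f : Measurable f := by
  have h : Measurable fun x : Simplex => F x.1 := measurable_F.comp measurable_subtype_coe
  have h' : ∀ a, Measurable fun x : Simplex => F x.1 a := fun a => (measurable_pi_apply a).comp h
  refine Measurable.subtype_mk (measurable_pi_lambda _ fun a => (h' a).div ?_)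
  unfold l1
  exact Finset.measurable_sum _ fun b _ => (h' b).norm

theorem measurable_coding : Measurable coding := by
  refine measurable_pi_lambda _ fun n => Measurable.ite ?_ measurable_const measurable_const
  have h : Measurable fun x : Simplex => (f^[n] x).1 :=
    measurable_subtype_coe.comp (measurable_f.iterate n)
  exact measurableSet_le ((measurable_pi_apply 2).comp h) ((measurable_pi_apply 0).comp h)

theorem measurable_prodMat (n : ℕ) (a b : Fin 3) : Measurable fun i => prodMat i n a b := by
  induction n generalizing b with
  | zero => simp only [prodMat_zero]; exact measurable_const
  | succ n ih =>
    simp only [prodMat_succ, Matrix.mul_apply]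
    refine Finset.measurable_sum _ fun c _ => (ih c).mul ?_
    exact (measurable_of_finite fun x : Fin 2 => C x c b).comp (measurable_pi_apply n)

theorem measurableSet_primitiveSeqs : MeasurableSet primitiveSeqs := by
  have : primitiveSeqs = ⋂ r, ⋃ k, ⋂ a, ⋂ b, {i | 0 < prodMat (shift^[r] i) k a b} := by
    ext i
    simp [mem_primitiveSeqs]
  rw [this]
  refine MeasurableSet.iInter fun r => MeasurableSet.iUnion fun k => MeasurableSet.iInter fun a =>
    MeasurableSet.iInter fun b => measurableSet_lt measurable_const ?_
  exact (measurable_prodMat k a b).comp (measurable_shift.iterate r)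

theorem measurableSet_irrationalVectors : MeasurableSet irrationalVectors := by
  have : irrationalVectors =
      ⋂ z : Fin 3 → ℤ, ⋂ _ : z ≠ 0, {x : Simplex | ∑ a, (z a : ℝ) * x.1 a = 0}ᶜ := by
    ext x
    simp only [mem_irrationalVectors, mem_iInter, mem_compl_iff, mem_ofPred_eq]
    exact forall_congr' fun z => not_imp_not.symm
  rw [this]
  refine MeasurableSet.iInter fun z => MeasurableSet.iInter fun _ => MeasurableSet.compl ?_
  refine measurableSet_eq_fun ?_ measurable_const
  exact Finset.measurable_sum _ fun a _ =>
    ((measurable_pi_apply a).comp measurable_subtype_coe).const_mul _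

/-- The measurable bijection between primitive sequences and totally irrational vectors. -/
noncomputable def projEquiv : primitiveSeqs ≃ᵐ irrationalVectors where
  toFun i := ⟨proj i.1, proj_mem_irrationalVectors i.2⟩
  invFun x := ⟨coding x.1, coding_mem_primitiveSeqs x.2⟩
  left_inv i := Subtype.ext (coding_proj i.2)
  right_inv x := Subtype.ext (proj_coding x.1)
  measurable_toFun := (continuous_proj.measurable.comp measurable_subtype_coe).subtype_mk
  measurable_invFun := (measurable_coding.comp measurable_subtype_coe).subtype_mk

theorem ae_mem_of_measure_eq_one {X : Type*} [MeasurableSpace X] {μ : Measure X}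
    [IsProbabilityMeasure μ] {s : Set X} (hs : MeasurableSet s) (h : μ s = 1) :
    ∀ᵐ x ∂μ, x ∈ s :=
  (prob_compl_eq_zero_iff hs).2 h

theorem isMPIsomorphism_proj {μ : Measure Seq} (hμ : IsProbabilityMeasure μ)
    (hS : MeasurePreserving shift μ μ) (hP : μ primitiveSeqs = 1) :
    IsMPIsomorphism shift μ f (Measure.map proj μ) proj := by
  have hae := ae_mem_of_measure_eq_one measurableSet_primitiveSeqs hP
  have hm := continuous_proj.measurable
  refine ⟨⟨hμ, hS⟩, ⟨Measure.isProbabilityMeasure_map hm.aemeasurable, measurable_f, ?_⟩,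
    primitiveSeqs, irrationalVectors, measurableSet_primitiveSeqs,
    measurableSet_irrationalVectors, hP, ?_, fun _ => shift_mem_primitiveSeqs,
    fun _ => f_mem_irrationalVectors, ⟨projEquiv, fun _ => rfl, projEquiv.measurable, ?_⟩,
    fun _ => proj_shift⟩
  -- The intertwining relation is available on primitive sequences, hence almost everywhere, which
  -- suffices for invariance.
  · rw [Measure.map_map measurable_f hm, Measure.map_congr (f := f ∘ proj) (g := proj ∘ shift)
      (hae.mono fun i hi => (proj_shift hi).symm), ← Measure.map_map hm measurable_shift, hS.map_eq]
  · rw [Measure.map_apply hm measurableSet_irrationalVectors]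
    refine le_antisymm prob_le_one (hP.symm.le.trans (measure_mono ?_))
    exact fun _ => proj_mem_irrationalVectors
  · ext B hB
    rw [Measure.map_apply projEquiv.measurable hB,
      (MeasurableEmbedding.subtype_coe measurableSet_primitiveSeqs).comap_apply,
      (MeasurableEmbedding.subtype_coe measurableSet_irrationalVectors).comap_apply,
      Measure.map_apply hm (measurableSet_irrationalVectors.subtype_image hB)]
    refine measure_congr (hae.mono fun i hi => propext ?_)
    constructor
    · rintro ⟨j, hj, rfl⟩
      exact ⟨_, hj, rfl⟩
    · rintro ⟨x, hx, e⟩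
      exact ⟨⟨i, hi⟩, by rwa [mem_preimage, show projEquiv ⟨i, hi⟩ = x from Subtype.ext e.symm], rfl⟩

theorem projInv_eq_coding {x : Simplex} (hx : x ∈ irrationalVectors) : projInv x = coding x := by
  have h : ∃ i ∈ primitiveSeqs, proj i = x := bijOn_proj.surjOn hx
  have e := coding_proj (Function.invFunOn_mem h)
  rw [Function.invFunOn_eq h] at e
  exact e.symm

/-- Almost everywhere `projInv` is the measurable map `coding`, and `proj ∘ coding = id` everywhere,
so this is the previous isomorphism applied to the push-forward of `ν` by `coding`. -/
theorem isMPIsomorphism_projInv {ν : Measure Simplex} (hν : IsProbabilityMeasure ν)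
    (hf : MeasurePreserving f ν ν) (hI : ν irrationalVectors = 1) :
    IsMPIsomorphism shift (Measure.map projInv ν) f ν proj := by
  have hae := ae_mem_of_measure_eq_one measurableSet_irrationalVectors hI
  have hm := continuous_proj.measurable
  have hc := measurable_coding
  rw [Measure.map_congr (g := coding) (hae.mono fun x hx => projInv_eq_coding hx)]
  have hprob : IsProbabilityMeasure (Measure.map coding ν) :=
    Measure.isProbabilityMeasure_map hc.aemeasurable
  have hmap : Measure.map proj (Measure.map coding ν) = ν := by
    rw [Measure.map_map hm hc, show proj ∘ coding = id from funext proj_coding, Measure.map_id]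
  have h := isMPIsomorphism_proj hprob ⟨measurable_shift, ?_⟩ ?_
  · rwa [hmap] at h
  · rw [Measure.map_map measurable_shift hc, show shift ∘ coding = coding ∘ f from
      funext fun x => (coding_f x).symm, ← Measure.map_map hc measurable_f, hf.map_eq]
  · rw [Measure.map_apply hc measurableSet_primitiveSeqs]
    refine le_antisymm prob_le_one (hI.symm.le.trans (measure_mono ?_))
    exact fun _ => coding_mem_primitiveSeqs

end Cassaigne

theorem theoremA :
    -- `π` is well defined, continuous and onto
    (∀ i : Cassaigne.Seq, Cassaigne.limitCone i = Cassaigne.ray (Cassaigne.proj i).1) ∧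
    Continuous Cassaigne.proj ∧
    Function.Surjective Cassaigne.proj ∧
    -- every point is recovered from its coding, which conjugates `f_C` to the shift
    (∀ x : Cassaigne.Simplex, Cassaigne.proj (Cassaigne.coding x) = x) ∧
    (∀ x : Cassaigne.Simplex,
      Cassaigne.coding (Cassaigne.f x) = Cassaigne.shift (Cassaigne.coding x)) ∧
    -- `π` restricts to a bijection from `𝒫` to `ℐ` that conjugates the shift to `f_C`
    Set.BijOn Cassaigne.proj Cassaigne.primitiveSeqs Cassaigne.irrationalVectors ∧
    (∀ i ∈ Cassaigne.primitiveSeqs,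
      Cassaigne.proj (Cassaigne.shift i) = Cassaigne.f (Cassaigne.proj i)) ∧
    -- shift-invariant measures with `μ(𝒫) = 1`
    (∀ μ : MeasureTheory.Measure Cassaigne.Seq, MeasureTheory.IsProbabilityMeasure μ →
      MeasureTheory.MeasurePreserving Cassaigne.shift μ μ →
      μ Cassaigne.primitiveSeqs = 1 →
      Cassaigne.IsMPIsomorphism Cassaigne.shift μ
        Cassaigne.f (MeasureTheory.Measure.map Cassaigne.proj μ) Cassaigne.proj) ∧
    -- `f_C`-invariant measures with `ν(ℐ) = 1`
    (∀ ν : MeasureTheory.Measure Cassaigne.Simplex, MeasureTheory.IsProbabilityMeasure ν →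
      MeasureTheory.MeasurePreserving Cassaigne.f ν ν →
      ν Cassaigne.irrationalVectors = 1 →
      Cassaigne.IsMPIsomorphism Cassaigne.shift (MeasureTheory.Measure.map Cassaigne.projInv ν)
        Cassaigne.f ν Cassaigne.proj) :=
  ⟨Cassaigne.limitCone_eq_ray_proj, Cassaigne.continuous_proj,
    fun x => ⟨_, Cassaigne.proj_coding x⟩, Cassaigne.proj_coding, Cassaigne.coding_f,
    Cassaigne.bijOn_proj, fun _ => Cassaigne.proj_shift,
    fun _ => Cassaigne.isMPIsomorphism_proj, fun _ => Cassaigne.isMPIsomorphism_projInv⟩
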